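/- Let $I=[a,b]$ with $a<b$, and let $\mathcal B^2(I)$ be the Bayes space: the set of (Lebesgue-a.e.) positive functions $f$ on $I$ with $\log f\in L^2(I)$, where $f$ and $g$ are identified if $f=c\,g$ a.e. for some constant $c>0$. It is a separable Hilbert space with addition $(f\oplus g)(t)=f(t)g(t)$, scalar multiplication $(r\odot f)(t)=f(t)^r$ and inner product $$\langle f,g\rangle_{B^2}=\frac1{2(b-a)}\int_I\int_I\log\frac{f(t)}{f(s)}\,\log\frac{g(t)}{g(s)}\,ds\,dt=\langle \mathrm{clr}(f),\mathrm{clr}(g)\rangle_{L^2(I)},\qquad \mathrm{clr}(f)=\log f-\frac1{b-a}\int_I\log f(t)\,dt .$$ Let $X$ be a random element of $\mathcal B^2(I)$ such that $\mathrm{clr}(X)$ is a Gaussian random element of $L^2(I)$, and whose mean $\mu$ in $\mathcal B^2(I)$ is constant (that is, $\mu$ is the neutral element of $\oplus$). Let $C$ be the covariance operator of $X$ in $\mathcal B^2(I)$, defined by $\langle Cf,g\rangle_{B^2}=\mathbb E\big(\langle X\ominus\mu,f\rangle_{B^2}\langle X\ominus\mu,g\rangle_{B^2}\big)$, and let $(\lambda_i,\zeta_i)_{i\ge1}$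 be its eigenpairs: $\lambda_1\ge\lambda_2\ge\dots\ge0$, $(\zeta_i)$ orthonormal, $C\zeta_i=\lambda_i\odot\zeta_i$ and $C=\sum_{i\ge1}\lambda_i\,\zeta_i\otimes\zeta_i$. Let $\alpha>0$ and let $k\ge0$ be an integer such that $\lambda_i>0$ for all $i\le k$. Let $C^{1/2}=\sum_{i\ge1}\lambda_i^{1/2}\,\zeta_i\otimes\zeta_i$, and let $W(k)$ be the orthogonal projection onto the orthogonal complement of $\mathrm{span}\{\zeta_1,\dots,\zeta_k\}$. Then for every $x\in\mathcal B^2(I)$ the functional $$Z\longmapsto\|C^{1/2}Z\ominus x\|_{B^2}^2+\alpha\,\|W(k)Z\|_{B^2}^2$$ has a unique minimizer $x_{\mathrm{st}}$ over $Z\in\mathcal B^2(I)$, and the squared regularized density Mahalanobis distance $$M^2_{\alpha,k}(X)=\|X_{\mathrm{st}}\ominus\mu_{\mathrm{st}}\|_{B^2}^2$$ satisfies $$M^2_{\alpha,k}(X)\ \sim\ \begin{cases}\displaystyle y+\sum_{i=k+1}^\infty\frac{\lambda_i^2}{(\lambda_i+\alpha)^2}\,\eta_i, & k\ge1,\\[2ex]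 \displaystyle\sum_{i=1}^\infty\frac{\lambda_i^2}{(\lambda_i+\alpha)^2}\,\eta_i, & k=0,\end{cases}$$ where $\eta_i\sim\chi^2(1)$, $i\ge1$, are mutually independent and also independent of $y\sim\chi^2(k)$. The series converges almost surely. -/

import Mathlib

open MeasureTheory ProbabilityTheory

noncomputable section

/-! ### The Bayes space of densities on the interval `I = [a, b]` -/

/-- Lebesgue measure on the interval `I = [a, b]`. -/
abbrev lebI (a b : ℝ) : Measure ℝ := volume.restrict (Set.Icc a b)

/-- The real Hilbert space `L²(I)`. -/
abbrev L2I (a b : ℝ) : Type := Lp ℝ 2 (lebI a b)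

/-- A (not necessarily normalised) density on `I`: an almost everywhere positive function whose
logarithm is square integrable. Measurability of the function itself follows. -/
structure LogDensity (a b : ℝ) where
  /-- the underlying function -/
  toFun : ℝ → ℝ
  pos : ∀ᵐ t ∂(lebI a b), 0 < toFun t
  memLp_log : MemLp (fun t => Real.log (toFun t)) 2 (lebI a b)

namespace LogDensity

variable {a b : ℝ}

/-- `f =_B g`: the two functions are proportional (almost everywhere on `I`). -/
def Equivalent (f g : LogDensity a b) : Prop :=
  ∃ c : ℝ, 0 < c ∧ ∀ᵐ t ∂(lebI a b), f.toFun t = c * g.toFun t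

/-- The constant density `1`. -/
def const (a b : ℝ) : LogDensity a b where
  toFun := fun _ => 1
  pos := by simp
  memLp_log := by simp

/-- Perturbation: `t ↦ f t * g t`. -/
def perturb (f g : LogDensity a b) : LogDensity a b where
  toFun := fun t => f.toFun t * g.toFun t
  pos := by
    filter_upwards [f.pos, g.pos] with t hf hg using mul_pos hf hg
  memLp_log := by
    refine (memLp_congr_ae ?_).1 (f.memLp_log.add g.memLp_log)
    filter_upwards [f.pos, g.pos] with t hf hg
    simp [Real.log_mul hf.ne' hg.ne']

/-- Powering: `t ↦ (f t) ^ r`. -/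
def power (r : ℝ) (f : LogDensity a b) : LogDensity a b where
  toFun := fun t => f.toFun t ^ r
  pos := by
    filter_upwards [f.pos] with t hf using Real.rpow_pos_of_pos hf r
  memLp_log := by
    refine (memLp_congr_ae ?_).1 (f.memLp_log.const_mul r)
    filter_upwards [f.pos] with t hf
    simp [Real.log_rpow hf]

/-- The Bayes inner product
`1 / (2 (b - a)) ∫ ∫ log (f t / f s) log (g t / g s) ds dt`. -/
def bayesInner (f g : LogDensity a b) : ℝ :=
  1 / (2 * (b - a)) * ∫ t in Set.Icc a b, ∫ s in Set.Icc a b,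
    Real.log (f.toFun t / f.toFun s) * Real.log (g.toFun t / g.toFun s)

/-- The centred log-ratio as a function: `log f - 1 / (b - a) ∫ log f`. -/
def clrFun (f : LogDensity a b) : ℝ → ℝ := fun t =>
  Real.log (f.toFun t) - 1 / (b - a) * ∫ s in Set.Icc a b, Real.log (f.toFun s)

lemma memLp_clrFun (f : LogDensity a b) : MemLp f.clrFun 2 (lebI a b) :=
  f.memLp_log.sub (memLp_const _)

/-- The centred log-ratio as an element of `L²(I)`. -/
def clr (f : LogDensity a b) : L2I a b := f.memLp_clrFun.toLp

lemma integrable_log (f : LogDensity a b) :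
    Integrable (fun t => Real.log (f.toFun t)) (lebI a b) :=
  f.memLp_log.integrable (by norm_num)

lemma lebI_eq_zero (h : b ≤ a) : lebI a b = 0 := by
  rw [Measure.restrict_eq_zero]
  simp [h]

lemma integral_one_div (h : a < b) (c : ℝ) :
    1 / (b - a) * ∫ _ in Set.Icc a b, c = c := by
  have : b - a ≠ 0 := (sub_pos.2 h).ne'
  simp [h.le]
  field_simp

/-- Two densities have the same centred log-ratio exactly when they are proportional. -/
lemma clr_eq_iff (f g : LogDensity a b) : f.clr = g.clr ↔ f.Equivalent g := by
  rw [clr, clr, MemLp.toLp_eq_toLp_iff]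
  rcases le_or_gt b a with h | h
  · have h0 := lebI_eq_zero h
    refine ⟨fun _ => ⟨1, one_pos, ?_⟩, fun _ => ?_⟩
    · rw [h0]
      simp
    · rw [h0]
      simp [Filter.EventuallyEq]
  constructor
  · intro hfg
    refine ⟨Real.exp (1 / (b - a) * (∫ s in Set.Icc a b, Real.log (f.toFun s))
      - 1 / (b - a) * (∫ s in Set.Icc a b, Real.log (g.toFun s))), Real.exp_pos _, ?_⟩
    filter_upwards [f.pos, g.pos, hfg] with t hf hg ht
    rw [clrFun, clrFun] at ht
    calc f.toFun t = Real.exp (Real.log (f.toFun t)) := (Real.exp_log hf).symm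
      _ = Real.exp ((1 / (b - a) * (∫ s in Set.Icc a b, Real.log (f.toFun s))
          - 1 / (b - a) * (∫ s in Set.Icc a b, Real.log (g.toFun s)))
          + Real.log (g.toFun t)) := by
        congr 1
        linarith
      _ = _ := by rw [Real.exp_add, Real.exp_log hg]
  · rintro ⟨c, hc, hfg⟩
    have hlog : ∀ᵐ t ∂(lebI a b),
        Real.log (f.toFun t) = Real.log c + Real.log (g.toFun t) := by
      filter_upwards [g.pos, hfg] with t hg ht
      rw [ht, Real.log_mul hc.ne' hg.ne']
    filter_upwards [hlog] with t ht
    rw [clrFun, clrFun, integral_congr_ae hlog, integral_add (integrable_const _) g.integrable_log,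
      mul_add, integral_one_div h, ht]
    ring

lemma clr_const : (const a b).clr = 0 := by
  refine (Lp.eq_zero_iff_ae_eq_zero).2 ?_
  filter_upwards [(const a b).memLp_clrFun.coeFn_toLp] with t ht
  rw [clr, ht]
  simp [clrFun, const]

lemma clr_perturb (f g : LogDensity a b) : (f.perturb g).clr = f.clr + g.clr := by
  rw [clr, clr, clr, ← MemLp.toLp_add, MemLp.toLp_eq_toLp_iff]
  have hlog : ∀ᵐ t ∂(lebI a b), Real.log ((f.perturb g).toFun t)
      = Real.log (f.toFun t) + Real.log (g.toFun t) := by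
    filter_upwards [f.pos, g.pos] with t hf hg
    simp [perturb, Real.log_mul hf.ne' hg.ne']
  filter_upwards [hlog] with t ht
  rw [Pi.add_apply, clrFun, clrFun, clrFun, integral_congr_ae hlog,
    integral_add f.integrable_log g.integrable_log, ht]
  ring

lemma clr_power (r : ℝ) (f : LogDensity a b) : (f.power r).clr = r • f.clr := by
  rw [clr, clr, ← MemLp.toLp_const_smul, MemLp.toLp_eq_toLp_iff]
  have hlog : ∀ᵐ t ∂(lebI a b), Real.log ((f.power r).toFun t) = r * Real.log (f.toFun t) := by
    filter_upwards [f.pos] with t hf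
    simp [power, Real.log_rpow hf]
  filter_upwards [hlog] with t ht
  rw [Pi.smul_apply, clrFun, clrFun, integral_congr_ae hlog, integral_const_mul, ht, smul_eq_mul]
  ring

/-- The Bayes inner product is the `L²(I)` inner product of the centred log-ratios. -/
lemma bayesInner_eq (f g : LogDensity a b) : f.bayesInner g = inner ℝ f.clr g.clr := by
  rcases le_or_gt b a with h | h
  · have h0 := lebI_eq_zero h
    rw [L2.inner_def]
    simp only [bayesInner]
    simp [h0]
  have hba : b - a ≠ 0 := (sub_pos.2 h).ne'
  set F : ℝ → ℝ := fun t => Real.log (f.toFun t) with hF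
  set G : ℝ → ℝ := fun t => Real.log (g.toFun t) with hG
  have iF : Integrable F (lebI a b) := f.integrable_log
  have iG : Integrable G (lebI a b) := g.integrable_log
  have iFG : Integrable (fun t => F t * G t) (lebI a b) :=
    f.memLp_log.integrable_mul g.memLp_log
  have hvol : (lebI a b).real Set.univ = b - a := by simp [h.le]
  have hconst : ∀ c : ℝ, ∫ _, c ∂(lebI a b) = (b - a) * c := fun c => by
    rw [integral_const, hvol, smul_eq_mul]
  have hR : inner ℝ f.clr g.clr = ∫ t, F t * G t ∂(lebI a b)
      - 1 / (b - a) * (∫ t, F t ∂(lebI a b)) * ∫ t, G t ∂(lebI a b) := by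
    set mF := 1 / (b - a) * ∫ t, F t ∂(lebI a b) with hmF
    set mG := 1 / (b - a) * ∫ t, G t ∂(lebI a b) with hmG
    rw [L2.inner_def]
    have : (fun t => inner ℝ (f.clr t) (g.clr t)) =ᵐ[lebI a b]
        fun t => F t * G t - mG * F t - mF * G t + mF * mG := by
      filter_upwards [f.memLp_clrFun.coeFn_toLp, g.memLp_clrFun.coeFn_toLp] with t h1 h2
      rw [clr, clr, h1, h2]
      simp only [clrFun, RCLike.inner_apply, conj_trivial, hmF, hmG, hF, hG]
      ring
    rw [integral_congr_ae this, integral_add, integral_sub, integral_sub, integral_const_mul,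
      integral_const_mul, hconst]
    · simp only [hmF, hmG]
      field_simp
      ring
    all_goals first
      | exact iFG
      | exact iF.const_mul _
      | exact iG.const_mul _
      | exact integrable_const _
      | exact iFG.sub (iF.const_mul _)
      | exact (iFG.sub (iF.const_mul _)).sub (iG.const_mul _)
  have hin : ∀ᵐ t ∂(lebI a b), ∫ s, Real.log (f.toFun t / f.toFun s)
        * Real.log (g.toFun t / g.toFun s) ∂(lebI a b)
      = (b - a) * (F t * G t) - (∫ s, G s ∂(lebI a b)) * F t - (∫ s, F s ∂(lebI a b)) * G t
        + ∫ s, F s * G s ∂(lebI a b) := by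
    filter_upwards [f.pos, g.pos] with t hf hg
    have : (fun s => Real.log (f.toFun t / f.toFun s) * Real.log (g.toFun t / g.toFun s))
        =ᵐ[lebI a b] fun s => F t * G t - F t * G s - G t * F s + F s * G s := by
      filter_upwards [f.pos, g.pos] with s hf' hg'
      rw [Real.log_div hf.ne' hf'.ne', Real.log_div hg.ne' hg'.ne']
      simp only [hF, hG]
      ring
    rw [integral_congr_ae this, integral_add, integral_sub, integral_sub, hconst]
    · simp only [integral_const_mul]
      ring
    all_goals first
      | exact iFG
      | exact iF.const_mul _
      | exact iG.const_mul _
      | exact integrable_const _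
      | exact (integrable_const _).sub (iG.const_mul _)
      | exact ((integrable_const _).sub (iG.const_mul _)).sub (iF.const_mul _)
  rw [hR, bayesInner, integral_congr_ae hin, integral_add, integral_sub, integral_sub,
    integral_const_mul, integral_const_mul, integral_const_mul, hconst]
  · field_simp
    ring
  all_goals first
    | exact iFG.const_mul _
    | exact iF.const_mul _
    | exact iG.const_mul _
    | exact integrable_const _
    | exact (iFG.const_mul _).sub (iF.const_mul _)
    | exact ((iFG.const_mul _).sub (iF.const_mul _)).sub (iG.const_mul _)

instance setoid (a b : ℝ) : Setoid (LogDensity a b) where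
  r := Equivalent
  iseqv :=
    ⟨fun f => (clr_eq_iff f f).1 rfl,
      fun {f g} h => (clr_eq_iff g f).1 ((clr_eq_iff f g).2 h).symm,
      fun {f g k} h h' =>
        (clr_eq_iff f k).1 (((clr_eq_iff f g).2 h).trans ((clr_eq_iff g k).2 h'))⟩

lemma equiv_iff (f g : LogDensity a b) : f ≈ g ↔ f.clr = g.clr := (clr_eq_iff f g).symm

end LogDensity

/-- The Bayes space `B²(I)`: positive densities on `I = [a, b]` with square-integrable logarithm,
up to proportionality. -/
def BayesSpace (a b : ℝ) : Type := Quotient (LogDensity.setoid a b)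

namespace BayesSpace

variable {a b : ℝ}

/-- The class of a density. -/
def mk (f : LogDensity a b) : BayesSpace a b := Quotient.mk _ f

/-- The centred log-ratio transformation `B²(I) → L²(I)`. -/
def clr : BayesSpace a b → L2I a b :=
  Quotient.lift LogDensity.clr fun f g h => (LogDensity.equiv_iff f g).1 h

lemma clr_injective : Function.Injective (clr : BayesSpace a b → L2I a b) := by
  rintro ⟨f⟩ ⟨g⟩ h
  exact Quotient.sound ((LogDensity.equiv_iff f g).2 h)

/-- The neutral element of perturbation is the class of the constant (uniform) density. -/
instance : Zero (BayesSpace a b) := ⟨mk (LogDensity.const a b)⟩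

/-- `f ⊕ g` is the class of the pointwise product. -/
instance : Add (BayesSpace a b) :=
  ⟨Quotient.map₂ LogDensity.perturb fun f f' h g g' h' => by
    rw [LogDensity.equiv_iff] at *
    rw [LogDensity.clr_perturb, LogDensity.clr_perturb, h, h']⟩

/-- `r ⊙ f` is the class of the pointwise power. -/
instance : SMul ℝ (BayesSpace a b) :=
  ⟨fun r => Quotient.map (LogDensity.power r) fun f f' h => by
    rw [LogDensity.equiv_iff] at *
    rw [LogDensity.clr_power, LogDensity.clr_power, h]⟩

instance : Neg (BayesSpace a b) := ⟨fun f => (-1 : ℝ) • f⟩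

instance : Sub (BayesSpace a b) := ⟨fun f g => f + (-1 : ℝ) • g⟩

instance : SMul ℕ (BayesSpace a b) := ⟨fun n f => (n : ℝ) • f⟩

instance : SMul ℤ (BayesSpace a b) := ⟨fun n f => (n : ℝ) • f⟩

lemma clr_zero : clr (0 : BayesSpace a b) = 0 := LogDensity.clr_const

lemma clr_add (f g : BayesSpace a b) : clr (f + g) = clr f + clr g := by
  rcases f with ⟨f⟩
  rcases g with ⟨g⟩
  exact LogDensity.clr_perturb f g

lemma clr_smul (r : ℝ) (f : BayesSpace a b) : clr (r • f) = r • clr f := by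
  rcases f with ⟨f⟩
  exact LogDensity.clr_power r f

instance : AddCommGroup (BayesSpace a b) :=
  clr_injective.addCommGroup clr clr_zero clr_add
    (fun f => by
      change clr ((-1 : ℝ) • f) = _
      rw [clr_smul, neg_one_smul])
    (fun f g => by
      change clr (f + (-1 : ℝ) • g) = _
      rw [clr_add, clr_smul, neg_one_smul, sub_eq_add_neg])
    (fun f n => by
      change clr ((n : ℝ) • f) = _
      rw [clr_smul, Nat.cast_smul_eq_nsmul])
    (fun f n => by
      change clr ((n : ℝ) • f) = _
      rw [clr_smul, Int.cast_smul_eq_zsmul])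

instance : Module ℝ (BayesSpace a b) :=
  clr_injective.module ℝ ⟨⟨clr, clr_zero⟩, clr_add⟩ clr_smul

/-- The Bayes inner product `⟨f, g⟩_{B²}`. -/
instance : Inner ℝ (BayesSpace a b) :=
  ⟨Quotient.lift₂ LogDensity.bayesInner fun f g f' g' h h' => by
    rw [LogDensity.equiv_iff] at *
    rw [LogDensity.bayesInner_eq, LogDensity.bayesInner_eq, h, h']⟩

lemma inner_eq (f g : BayesSpace a b) : inner ℝ f g = inner ℝ (clr f) (clr g) := by
  rcases f with ⟨f⟩
  rcases g with ⟨g⟩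
  exact LogDensity.bayesInner_eq f g

/-- The Bayes inner product is a positive definite symmetric bilinear form. -/
@[reducible]
def core (a b : ℝ) : InnerProductSpace.Core ℝ (BayesSpace a b) where
  inner := inner ℝ
  conj_inner_symm f g := by
    rw [inner_eq, inner_eq]
    exact inner_conj_symm _ _
  re_inner_nonneg f := by
    rw [inner_eq]
    exact inner_self_nonneg
  add_left f g k := by
    simp only [inner_eq, clr_add, inner_add_left]
  smul_left f g r := by
    simp only [inner_eq, clr_smul, inner_smul_left]
  definite f h := by
    rw [inner_eq, inner_self_eq_zero] at h
    exact clr_injective (h.trans clr_zero.symm)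

instance : NormedAddCommGroup (BayesSpace a b) := (core a b).toNormedAddCommGroup

instance : InnerProductSpace ℝ (BayesSpace a b) := InnerProductSpace.ofCore (core a b).toCore

/-- The centred log-ratio as a linear isometry. -/
def clrL (a b : ℝ) : BayesSpace a b →ₗᵢ[ℝ] L2I a b where
  toFun := clr
  map_add' := clr_add
  map_smul' := clr_smul
  norm_map' f := by
    have h : inner ℝ f f = inner ℝ (clr f) (clr f) := inner_eq f f
    have h1 : inner ℝ f f = ‖f‖ ^ 2 := real_inner_self_eq_norm_sq f
    have h2 : inner ℝ (clr f) (clr f) = ‖clr f‖ ^ 2 := real_inner_self_eq_norm_sq _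
    rw [h1, h2] at h
    exact ((sq_eq_sq₀ (norm_nonneg _) (norm_nonneg _)).1 h).symm

/-- The image of the centred log-ratio is `L²₀(I)`, the functions integrating to zero. -/
lemma range_clr : Set.range (clr : BayesSpace a b → L2I a b)
    = {u : L2I a b | ∫ t, u t ∂(lebI a b) = 0} := by
  ext u
  constructor
  · rintro ⟨⟨f⟩, rfl⟩
    change ∫ t, f.clr t ∂(lebI a b) = 0
    rcases le_or_gt b a with h | h
    · simp [LogDensity.lebI_eq_zero h]
    rw [LogDensity.clr, integral_congr_ae f.memLp_clrFun.coeFn_toLp]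
    simp only [LogDensity.clrFun]
    rw [integral_sub f.integrable_log (integrable_const _)]
    have : b - a ≠ 0 := (sub_pos.2 h).ne'
    simp [h.le]
    field_simp
    simp
  · intro hu
    let f : LogDensity a b :=
      { toFun := fun t => Real.exp (u t)
        pos := Filter.Eventually.of_forall fun t => Real.exp_pos _
        memLp_log := by simpa using Lp.memLp u }
    refine ⟨mk f, ?_⟩
    change f.clr = u
    refine Lp.ext ?_
    filter_upwards [f.memLp_clrFun.coeFn_toLp] with t ht
    rw [LogDensity.clr, ht]
    have hu' : ∫ t, u t ∂(lebI a b) = 0 := hu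
    simp [LogDensity.clrFun, f, hu']

instance : CompleteSpace (BayesSpace a b) := by
  have hcl : IsClosed (Set.range (clrL a b)) := by
    have h : Set.range (clrL a b) = {u : L2I a b | ∫ t, u t ∂(lebI a b) = 0} := range_clr
    rw [h]
    have hE : ∀ u : L2I a b, ∫ t, u t ∂(lebI a b)
        = inner ℝ ((memLp_const (1 : ℝ) : MemLp _ 2 (lebI a b)).toLp) u := by
      intro u
      rw [L2.inner_def]
      refine integral_congr_ae ?_
      filter_upwards [(memLp_const (1 : ℝ) : MemLp _ 2 (lebI a b)).coeFn_toLp] with t ht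
      rw [ht]
      simp
    simp only [hE]
    exact isClosed_eq (by fun_prop) continuous_const
  exact (completeSpace_iff_isComplete_range (clrL a b).isometry.isUniformInducing).2 hcl.isComplete

instance : MeasurableSpace (BayesSpace a b) := borel _

instance : BorelSpace (BayesSpace a b) := ⟨rfl⟩

instance : SecondCountableTopology (BayesSpace a b) :=
  haveI : Fact ((2 : ENNReal) ≠ ⊤) := ⟨by simp⟩
  (clrL a b).isometry.isEmbedding.secondCountableTopology

/-! ### Mean and covariance of a random density -/

/-- The Bayes mean of a random density. -/
def mean {Ω : Type*} [MeasurableSpace Ω] (P : Measure Ω) (X : Ω → BayesSpace a b) :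
    BayesSpace a b :=
  ∫ ω, X ω ∂P

/-- The Bayes mean `m` satisfies `⟨m, f⟩ = E ⟨X, f⟩`. -/
lemma inner_mean {Ω : Type*} [MeasurableSpace Ω] {P : Measure Ω} {X : Ω → BayesSpace a b}
    (hX : Integrable X P) (f : BayesSpace a b) :
    inner ℝ (mean P X) f = ∫ ω, inner ℝ (X ω) f ∂P := by
  rw [mean, real_inner_comm, ← integral_inner hX]
  simp only [real_inner_comm]

/-- The Bayes covariance operator of a random density: Mathlib's (uncentred) covariance operator of
the law of the centred random density `X ⊖ m`. -/
def cov {Ω : Type*} [MeasurableSpace Ω] (P : Measure Ω) (X : Ω → BayesSpace a b) :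
    BayesSpace a b →L[ℝ] BayesSpace a b :=
  covarianceOperator (P.map fun ω => X ω - mean P X)

/-- The Bayes covariance operator satisfies `⟨C f, g⟩ = E (⟨X ⊖ m, f⟩ ⟨X ⊖ m, g⟩)`. -/
lemma inner_cov {Ω : Type*} [MeasurableSpace Ω] {P : Measure Ω} [IsFiniteMeasure P]
    {X : Ω → BayesSpace a b} (hX : MemLp X 2 P) (f g : BayesSpace a b) :
    inner ℝ (cov P X f) g
      = ∫ ω, inner ℝ (X ω - mean P X) f * inner ℝ (X ω - mean P X) g ∂P := by
  have h : MemLp (fun ω => X ω - mean P X) 2 P := hX.sub (memLp_const _)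
  have hm : AEMeasurable (fun ω => X ω - mean P X) P := h.aestronglyMeasurable.aemeasurable
  have h2 : MemLp id 2 (P.map fun ω => X ω - mean P X) :=
    (memLp_map_measure_iff measurable_id.aestronglyMeasurable hm).2 h
  rw [cov, covarianceOperator_inner h2, integral_map hm (by fun_prop)]
  simp only [real_inner_comm]

/-! ### Regularised standardisation and regularised density Mahalanobis distance -/

/-- `(lam i, ζ i)`, `i = 0, 1, 2, …`, are the eigenpairs of the operator `C`: orthonormal
eigenvectors with the eigenvalues in nonincreasing order, such that `C = ∑ lam i • ζ i ⊗ ζ i`.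
So every nonzero eigenvalue of `C` occurs, repeated according to its multiplicity. -/
structure IsEigenpairs (C : BayesSpace a b →L[ℝ] BayesSpace a b) (lam : ℕ → ℝ)
    (ζ : ℕ → BayesSpace a b) : Prop where
  orthonormal : Orthonormal ℝ ζ
  antitone : Antitone lam
  eigen : ∀ i, C (ζ i) = lam i • ζ i
  hasSum : ∀ f, HasSum (fun i => lam i • inner ℝ (ζ i) f • ζ i) (C f)

/-- The operator `C ^ (1 / 2)`, for `C` with eigenpairs `(lam i, ζ i)`. -/
def sqrtOp (lam : ℕ → ℝ) (ζ : ℕ → BayesSpace a b) (f : BayesSpace a b) : BayesSpace a b :=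
  ∑' i, √(lam i) • inner ℝ (ζ i) f • ζ i

/-- `W(k)`: the orthogonal projection onto the complement of the span of the first `k`
eigenvectors `ζ 0, …, ζ (k - 1)`. -/
def residualProj (k : ℕ) (ζ : ℕ → BayesSpace a b) : BayesSpace a b →L[ℝ] BayesSpace a b :=
  (Submodule.span ℝ (ζ '' Set.Iio k))ᗮ.starProjection

/-- The objective `Z ↦ ‖C ^ (1 / 2) Z ⊖ x‖² + α ‖W(k) Z‖²`. -/
def objective (α : ℝ) (k : ℕ) (lam : ℕ → ℝ) (ζ : ℕ → BayesSpace a b) (x Z : BayesSpace a b) : ℝ :=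
  ‖sqrtOp lam ζ Z - x‖ ^ 2 + α * ‖residualProj k ζ Z‖ ^ 2

/-- `Z` is a minimiser over `B²(I)` of the objective. -/
def IsStandardization (α : ℝ) (k : ℕ) (lam : ℕ → ℝ) (ζ : ℕ → BayesSpace a b)
    (x Z : BayesSpace a b) : Prop :=
  IsMinOn (objective α k lam ζ x) Set.univ Z

/-- The regularised standardisation `x_st^{α, k}`: the minimiser of the objective. -/
def standardization (α : ℝ) (k : ℕ) (lam : ℕ → ℝ) (ζ : ℕ → BayesSpace a b) (x : BayesSpace a b) :
    BayesSpace a b :=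
  Classical.epsilon (IsStandardization α k lam ζ x)

/-- The squared regularised density Mahalanobis distance `M²_{α, k}(x, y; C)`, for `C` with
eigenpairs `(lam i, ζ i)`. -/
def sqMahalanobis (α : ℝ) (k : ℕ) (lam : ℕ → ℝ) (ζ : ℕ → BayesSpace a b) (x y : BayesSpace a b) :
    ℝ :=
  ‖standardization α k lam ζ x - standardization α k lam ζ y‖ ^ 2

end BayesSpace

instance (a b : ℝ) : MeasurableSpace (L2I a b) := borel _

instance (a b : ℝ) : BorelSpace (L2I a b) := ⟨rfl⟩

/-- The chi-squared distribution with `k` degrees of freedom: the law of the sum of the squares of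
`k` independent standard normal variables. -/
def chiSquared (k : ℕ) : Measure ℝ :=
  (Measure.pi fun _ : Fin k => gaussianReal 0 1).map fun z => ∑ i, z i ^ 2

end

/-! The objective is quadratic and diagonal along `ζ`. Its minimiser multiplies the coordinate `⟨ζ
i, x⟩` by `c i = stdCoeff α k lam i`, that is `1 / √λ_i` for `i < k` and `√λ_i / (λ_i + α)` for `i ≥
k`, and has no component orthogonal to all `ζ i`. Since `z = diagOp c ζ x` solves the normal
equation (`normal_equation`), the objective at `Z` is its value at `z` plus the purely quadratic
objective at `Z - z` (`objective_eq`). The latter vanishes only at `0`, which gives existence and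
uniqueness.

Hence `M² = ∑ c_i² ξ_i²` with `ξ_i = ⟨ζ i, X⟩`. The `ξ_i` are jointly Gaussian and centred, with
covariances `⟨C ζ_i, ζ_j⟩ = λ_i δ_ij`, so they are independent `N(0, λ_i)`. As `c_i² λ_i` is `1` for
`i < k` and `λ_i² / (λ_i + α)²` beyond, the first `k` terms add up to `χ²(k)` (`hasLaw_head`) and
the tail has the law of the weighted sequence (`identDistrib_tail`). Summability of a nonnegative
sequence is a measurable event, so the almost sure convergence of the `η` series is inherited from
that of `M²`, without moment estimates. -/

noncomputable section

/-! ### Diagonal operators along an orthonormal sequence, not necessarily a basis. -/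

section Diagonal

variable {H : Type*} [NormedAddCommGroup H] [InnerProductSpace ℝ H]

/-- The diagonal operator with entries `d` along the family `ζ`. -/
def diagOp (d : ℕ → ℝ) (ζ : ℕ → H) (f : H) : H :=
  ∑' i, d i • inner ℝ (ζ i) f • ζ i

variable {ζ : ℕ → H} {d : ℕ → ℝ} {B : ℝ}

lemma diagOp_zero : diagOp d ζ 0 = 0 := by simp [diagOp]

variable [CompleteSpace H]

lemma residual_starProjection (hζ : Orthonormal ℝ ζ) (k : ℕ) (f : H) :
    (Submodule.span ℝ (ζ '' Set.Iio k))ᗮ.starProjection f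
      = f - ∑ i ∈ Finset.range k, inner ℝ (ζ i) f • ζ i := by
  have hmem : ∑ i ∈ Finset.range k, inner ℝ (ζ i) f • ζ i
      ∈ Submodule.span ℝ (ζ '' Set.Iio k) :=
    Submodule.sum_mem _ fun i hi => Submodule.smul_mem _ _
      (Submodule.subset_span ⟨i, by simpa using hi, rfl⟩)
  refine Submodule.eq_starProjection_of_mem_orthogonal ?_ ?_
  · rw [Submodule.mem_orthogonal]
    intro u hu
    induction hu using Submodule.span_induction with
    | mem u hu =>
      obtain ⟨j, hj, rfl⟩ := hu
      have hj' : j < k := hj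
      rw [inner_sub_right, inner_sum, Finset.sum_eq_single j]
      · rw [inner_smul_right, real_inner_self_eq_norm_sq, hζ.1 j]
        ring
      · intro i _ hij
        rw [inner_smul_right, hζ.2 hij.symm, mul_zero]
      · simp [hj']
    | zero => simp
    | add u v _ _ hu hv => rw [inner_add_left, hu, hv, add_zero]
    | smul c u _ hu => rw [inner_smul_left, hu, mul_zero]
  · rw [sub_sub_cancel]
    exact Submodule.le_orthogonal_orthogonal _ hmem

/-- An orthogonal series converges when its squared norms are summable; here Bessel's inequality
bounds them, up to the factor `B ^ 2`. -/
lemma hasSum_diagOp (hζ : Orthonormal ℝ ζ) (hd : ∀ i, |d i| ≤ B) (f : H) :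
    HasSum (fun i => d i • inner ℝ (ζ i) f • ζ i) (diagOp d ζ f) := by
  refine Summable.hasSum ?_
  have h := (hζ.orthogonalFamily.summable_iff_norm_sq_summable
    (fun i => d i * inner ℝ (ζ i) f)).2 ?_
  · simpa [LinearIsometry.toSpanSingleton_apply, mul_smul] using h
  · refine Summable.of_nonneg_of_le (fun i => sq_nonneg _) (fun i => ?_)
      ((hζ.inner_products_summable f).mul_left (B ^ 2))
    rw [norm_mul, mul_pow]
    gcongr
    exact hd i

lemma hasSum_inner_diagOp (hζ : Orthonormal ℝ ζ) (hd : ∀ i, |d i| ≤ B) (f g : H) :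
    HasSum (fun i => d i * inner ℝ (ζ i) f * inner ℝ (ζ i) g) (inner ℝ (diagOp d ζ f) g) := by
  have h := (hasSum_diagOp hζ hd f).mapL (innerSL ℝ g)
  simp only [innerSL_apply_apply, inner_smul_right] at h
  rw [real_inner_comm] at h
  convert! h using 2 with i
  rw [real_inner_comm g, mul_assoc]

lemma inner_diagOp (hζ : Orthonormal ℝ ζ) (hd : ∀ i, |d i| ≤ B) (f : H) (j : ℕ) :
    inner ℝ (ζ j) (diagOp d ζ f) = d j * inner ℝ (ζ j) f := by
  rw [real_inner_comm]
  refine (hasSum_inner_diagOp hζ hd f (ζ j)).unique ?_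
  convert! hasSum_single (f := fun i => d i * inner ℝ (ζ i) f * inner ℝ (ζ i) (ζ j)) j ?_ using 1
  · simp [hζ.1 j]
  · intro i hij
    simp [hζ.2 hij]

lemma diagOp_add (hζ : Orthonormal ℝ ζ) (hd : ∀ i, |d i| ≤ B) (f g : H) :
    diagOp d ζ (f + g) = diagOp d ζ f + diagOp d ζ g := by
  refine (hasSum_diagOp hζ hd (f + g)).unique ?_
  simpa only [inner_add_right, add_smul, smul_add] using
    (hasSum_diagOp hζ hd f).add (hasSum_diagOp hζ hd g)

lemma hasSum_norm_sq_diagOp (hζ : Orthonormal ℝ ζ) (hd : ∀ i, |d i| ≤ B) (f : H) :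
    HasSum (fun i => d i ^ 2 * inner ℝ (ζ i) f ^ 2) (‖diagOp d ζ f‖ ^ 2) := by
  rw [← real_inner_self_eq_norm_sq]
  convert! hasSum_inner_diagOp hζ hd f (diagOp d ζ f) using 2 with i
  rw [inner_diagOp hζ hd]
  ring

end Diagonal

/-! ### Coefficients of the minimiser and the normal equation. -/

section Standardization

/-- The factors by which the regularised standardisation multiplies the coordinates. -/
def stdCoeff (α : ℝ) (k : ℕ) (lam : ℕ → ℝ) (i : ℕ) : ℝ :=
  if i < k then (√(lam i))⁻¹ else √(lam i) / (lam i + α)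

variable {α : ℝ} {k : ℕ} {lam : ℕ → ℝ}

lemma stdCoeff_nonneg (hα : 0 < α) (h0 : ∀ i, 0 ≤ lam i) (i : ℕ) : 0 ≤ stdCoeff α k lam i := by
  have := h0 i
  unfold stdCoeff
  split_ifs <;> positivity

lemma exists_abs_stdCoeff_le (hα : 0 < α) (h0 : ∀ i, 0 ≤ lam i) (hlam : Antitone lam) :
    ∃ B, ∀ i, |stdCoeff α k lam i| ≤ B := by
  -- The finitely many inverses are bounded by their sum; from `k` on, `lam i + α ≥ α` and `lam i ≤
  -- lam 0`.
  refine ⟨∑ j ∈ Finset.range k, (√(lam j))⁻¹ + √(lam 0) / α, fun i => ?_⟩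
  rw [abs_of_nonneg (stdCoeff_nonneg hα h0 i)]
  have h1 : 0 ≤ ∑ j ∈ Finset.range k, (√(lam j))⁻¹ := Finset.sum_nonneg fun _ _ => by positivity
  have h2 : 0 ≤ √(lam 0) / α := by positivity
  unfold stdCoeff
  split_ifs with h
  · have := Finset.single_le_sum (f := fun j => (√(lam j))⁻¹) (fun _ _ => by positivity)
      (Finset.mem_range.2 h)
    linarith
  · have : √(lam i) / (lam i + α) ≤ √(lam 0) / α := by
      gcongr
      · exact hlam (Nat.zero_le i)
      · linarith [h0 i]
    linarith

lemma abs_sqrt_le (hlam : Antitone lam) (i : ℕ) : |√(lam i)| ≤ √(lam 0) := by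
  rw [abs_of_nonneg (Real.sqrt_nonneg _)]
  exact Real.sqrt_le_sqrt (hlam (Nat.zero_le i))

/-- The regularised normal equation, coordinatewise. -/
lemma stdCoeff_normal (hα : 0 < α) (h0 : ∀ i, 0 ≤ lam i) (hk : ∀ i < k, 0 < lam i) (i : ℕ) :
    √(lam i) * (√(lam i) * stdCoeff α k lam i - 1)
      + α * (stdCoeff α k lam i - if i < k then stdCoeff α k lam i else 0) = 0 := by
  unfold stdCoeff
  split_ifs with h
  · have : √(lam i) ≠ 0 := (Real.sqrt_pos.2 (hk i h)).ne'
    field_simp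
    ring
  · have h1 : lam i + α ≠ 0 := by linarith [h0 i]
    have h2 := Real.mul_self_sqrt (h0 i)
    field_simp
    linear_combination (√(lam i)) * h2

variable {H : Type*} [NormedAddCommGroup H] [InnerProductSpace ℝ H] [CompleteSpace H] {ζ : ℕ → H}

/-- Half the derivative of the objective at `z` in the direction `v`. Both inner products expand in
the coordinates of `x` and `v`, and each term vanishes by `stdCoeff_normal`. -/
lemma normal_equation (hα : 0 < α) (hζ : Orthonormal ℝ ζ) (hlam : Antitone lam)
    (h0 : ∀ i, 0 ≤ lam i) (hk : ∀ i < k, 0 < lam i) (x v : H) :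
    inner ℝ (diagOp (fun i => √(lam i)) ζ v)
        (diagOp (fun i => √(lam i)) ζ (diagOp (stdCoeff α k lam) ζ x) - x)
      + α * inner ℝ ((Submodule.span ℝ (ζ '' Set.Iio k))ᗮ.starProjection v)
        ((Submodule.span ℝ (ζ '' Set.Iio k))ᗮ.starProjection (diagOp (stdCoeff α k lam) ζ x))
      = 0 := by
  obtain ⟨B, hB⟩ := exists_abs_stdCoeff_le (k := k) hα h0 hlam
  set z := diagOp (stdCoeff α k lam) ζ x with hz
  have h1 := hasSum_inner_diagOp hζ (abs_sqrt_le hlam) v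
    (diagOp (fun i => √(lam i)) ζ z - x)
  have h2 := hasSum_inner_diagOp hζ hB x v
  -- The finite sum is written as a series over `ℕ`, so that it can be combined termwise with the
  -- other two.
  have h3 : HasSum (fun i => if i < k then inner ℝ (ζ i) z * inner ℝ (ζ i) v else 0)
      (∑ i ∈ Finset.range k, inner ℝ (ζ i) z * inner ℝ (ζ i) v) := by
    have h := hasSum_sum_of_ne_finset_zero (L := .unconditional ℕ)
      (f := fun i => if i < k then inner ℝ (ζ i) z * inner ℝ (ζ i) v else 0)
      (s := Finset.range k) (fun i hi => if_neg (by simpa using hi))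
    rwa [Finset.sum_congr rfl fun i hi => if_pos (Finset.mem_range.1 hi)] at h
  have hW : inner ℝ ((Submodule.span ℝ (ζ '' Set.Iio k))ᗮ.starProjection v)
        ((Submodule.span ℝ (ζ '' Set.Iio k))ᗮ.starProjection z)
      = inner ℝ z v - ∑ i ∈ Finset.range k, inner ℝ (ζ i) z * inner ℝ (ζ i) v := by
    -- The projection is self-adjoint and idempotent, so it needs to be computed on `z` only.
    rw [Submodule.inner_starProjection_left_eq_right,
      Submodule.starProjection_eq_self_iff.2 (Submodule.starProjection_apply_mem _ _),
      residual_starProjection hζ, inner_sub_right, inner_sum, real_inner_comm]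
    simp only [inner_smul_right, real_inner_comm]
  rw [hW]
  refine (h1.add ((h2.sub h3).mul_left α)).unique ?_
  convert! hasSum_zero (α := ℝ) (β := ℕ) using 2 with i
  have hi := stdCoeff_normal hα h0 hk i
  rw [inner_sub_right, inner_diagOp hζ (abs_sqrt_le hlam), hz, inner_diagOp hζ hB]
  split_ifs with h
  · rw [if_pos h] at hi
    linear_combination (inner ℝ (ζ i) x * inner ℝ (ζ i) v) * hi
  · rw [if_neg h] at hi
    linear_combination (inner ℝ (ζ i) x * inner ℝ (ζ i) v) * hi

end Standardization

/-! ### Existence, uniqueness and formula for the standardisation. -/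

namespace BayesSpace

variable {a b α : ℝ} {k : ℕ} {lam : ℕ → ℝ} {ζ : ℕ → BayesSpace a b}

/-- Completing the square: the cross terms are twice the left side of the normal equation. -/
lemma objective_eq (hα : 0 < α) (hζ : Orthonormal ℝ ζ) (hlam : Antitone lam)
    (h0 : ∀ i, 0 ≤ lam i) (hk : ∀ i < k, 0 < lam i) (x Z : BayesSpace a b) :
    objective α k lam ζ x Z = objective α k lam ζ x (diagOp (stdCoeff α k lam) ζ x)
      + objective α k lam ζ 0 (Z - diagOp (stdCoeff α k lam) ζ x) := by
  set z := diagOp (stdCoeff α k lam) ζ x with hz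
  obtain ⟨v, rfl⟩ : ∃ v, Z = v + z := ⟨Z - z, by abel⟩
  have hn : inner ℝ (sqrtOp lam ζ v) (sqrtOp lam ζ z - x)
      + α * inner ℝ (residualProj k ζ v) (residualProj k ζ z) = 0 :=
    normal_equation hα hζ hlam h0 hk x v
  have hS : sqrtOp lam ζ (v + z) - x = sqrtOp lam ζ v + (sqrtOp lam ζ z - x) := by
    rw [show sqrtOp lam ζ (v + z) = sqrtOp lam ζ v + sqrtOp lam ζ z from
      diagOp_add hζ (abs_sqrt_le hlam) v z]
    abel
  rw [objective, hS, map_add, norm_add_sq_real, norm_add_sq_real, objective, objective,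
    add_sub_cancel_right, sub_zero]
  linear_combination 2 * hn

lemma objective_nonneg (hα : 0 < α) (x Z : BayesSpace a b) : 0 ≤ objective α k lam ζ x Z := by
  unfold objective
  positivity

/-- A vanishing penalty puts `v` in the span of `ζ 0, …, ζ (k - 1)`, on which `C ^ (1 / 2)` is
injective because these eigenvalues are positive. -/
lemma eq_zero_of_objective_zero (hα : 0 < α) (hζ : Orthonormal ℝ ζ) (hlam : Antitone lam)
    (hk : ∀ i < k, 0 < lam i) {v : BayesSpace a b} (hv : objective α k lam ζ 0 v = 0) : v = 0 := by
  unfold objective at hv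
  rw [sub_zero] at hv
  have hS : ‖sqrtOp lam ζ v‖ ^ 2 = 0 := by
    have := mul_nonneg hα.le (sq_nonneg ‖residualProj k ζ v‖)
    nlinarith [sq_nonneg ‖sqrtOp lam ζ v‖]
  have hW : ‖residualProj k ζ v‖ ^ 2 = 0 := by
    rw [hS, zero_add] at hv
    exact (mul_eq_zero.1 hv).resolve_left hα.ne'
  rw [sq_eq_zero_iff, norm_eq_zero] at hS hW
  rw [residualProj, residual_starProjection hζ, sub_eq_zero] at hW
  rw [hW]
  refine Finset.sum_eq_zero fun i hi => ?_
  have h := inner_diagOp hζ (abs_sqrt_le hlam) v i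
  rw [show diagOp (fun i => √(lam i)) ζ v = 0 from hS, inner_zero_right] at h
  rw [(mul_eq_zero.1 h.symm).resolve_left
    (Real.sqrt_pos.2 (hk i (Finset.mem_range.1 hi))).ne', zero_smul]

lemma isStandardization_iff (hα : 0 < α) (hζ : Orthonormal ℝ ζ) (hlam : Antitone lam)
    (h0 : ∀ i, 0 ≤ lam i) (hk : ∀ i < k, 0 < lam i) (x Z : BayesSpace a b) :
    IsStandardization α k lam ζ x Z ↔ Z = diagOp (stdCoeff α k lam) ζ x := by
  unfold IsStandardization
  rw [isMinOn_univ_iff]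
  constructor
  · intro h
    have h1 := h (diagOp (stdCoeff α k lam) ζ x)
    rw [objective_eq hα hζ hlam h0 hk x Z] at h1
    refine sub_eq_zero.1 (eq_zero_of_objective_zero hα hζ hlam hk (le_antisymm ?_
      (objective_nonneg hα _ _)))
    linarith
  · rintro rfl Z
    rw [objective_eq hα hζ hlam h0 hk x Z]
    linarith [objective_nonneg (k := k) (lam := lam) (ζ := ζ) hα 0
      (Z - diagOp (stdCoeff α k lam) ζ x)]

lemma existsUnique_isStandardization (hα : 0 < α) (hζ : Orthonormal ℝ ζ) (hlam : Antitone lam)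
    (h0 : ∀ i, 0 ≤ lam i) (hk : ∀ i < k, 0 < lam i) (x : BayesSpace a b) :
    ∃! Z, IsStandardization α k lam ζ x Z := by
  simp only [isStandardization_iff hα hζ hlam h0 hk, existsUnique_eq]

lemma standardization_eq (hα : 0 < α) (hζ : Orthonormal ℝ ζ) (hlam : Antitone lam)
    (h0 : ∀ i, 0 ≤ lam i) (hk : ∀ i < k, 0 < lam i) (x : BayesSpace a b) :
    standardization α k lam ζ x = diagOp (stdCoeff α k lam) ζ x :=
  (isStandardization_iff hα hζ hlam h0 hk x _).1
    (Classical.epsilon_spec (existsUnique_isStandardization hα hζ hlam h0 hk x).exists)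

lemma hasSum_sqMahalanobis (hα : 0 < α) (hζ : Orthonormal ℝ ζ) (hlam : Antitone lam)
    (h0 : ∀ i, 0 ≤ lam i) (hk : ∀ i < k, 0 < lam i) (x : BayesSpace a b) :
    HasSum (fun i => stdCoeff α k lam i ^ 2 * inner ℝ (ζ i) x ^ 2)
      (sqMahalanobis α k lam ζ x 0) := by
  obtain ⟨B, hB⟩ := exists_abs_stdCoeff_le (k := k) hα h0 hlam
  rw [sqMahalanobis, standardization_eq hα hζ hlam h0 hk, standardization_eq hα hζ hlam h0 hk,
    diagOp_zero, sub_zero]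
  exact hasSum_norm_sq_diagOp hζ hB x

end BayesSpace

/-! ### Laws of sums of nonnegative series. -/

section SeriesLaw

/-- The sequences of nonnegative terms with a finite sum. -/
def nonnegSummable : Set (ℕ → ℝ) :=
  {s | (∀ i, 0 ≤ s i) ∧ ∑' i, ENNReal.ofReal (s i) < ⊤}

lemma mem_nonnegSummable {s : ℕ → ℝ} : s ∈ nonnegSummable ↔ (∀ i, 0 ≤ s i) ∧ Summable s := by
  refine and_congr_right fun h => ⟨fun hs => ?_, fun hs => ?_⟩
  · simpa only [ENNReal.toReal_ofReal (h _)] using ENNReal.summable_toReal hs.ne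
  · rw [← ENNReal.ofReal_tsum_of_nonneg h hs]
    exact ENNReal.ofReal_lt_top

/-- Sums are taken in `ENNReal`, where every series converges; the real `∑'` is recovered on
`nonnegSummable`. -/
lemma measurable_tsum_ofReal :
    Measurable fun s : ℕ → ℝ => ∑' i, ENNReal.ofReal (s i) :=
  .tsum fun i => (measurable_pi_apply i).ennreal_ofReal

lemma measurableSet_nonnegSummable : MeasurableSet nonnegSummable := by
  have h : nonnegSummable = (⋂ i, {s : ℕ → ℝ | 0 ≤ s i})
      ∩ (fun s : ℕ → ℝ => ∑' i, ENNReal.ofReal (s i)) ⁻¹' Set.Iio ⊤ := by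
    ext
    simp [nonnegSummable]
  rw [h]
  exact (MeasurableSet.iInter fun i => measurableSet_le measurable_const
    (measurable_pi_apply i)).inter (measurable_tsum_ofReal measurableSet_Iio)

lemma toReal_tsum_ofReal {s : ℕ → ℝ} (hs : s ∈ nonnegSummable) :
    (∑' i, ENNReal.ofReal (s i)).toReal = ∑' i, s i := by
  obtain ⟨h0, h⟩ := mem_nonnegSummable.1 hs
  rw [← ENNReal.ofReal_tsum_of_nonneg h0 h, ENNReal.toReal_ofReal (tsum_nonneg h0)]

variable {Ω Ω' : Type*} [MeasurableSpace Ω] [MeasurableSpace Ω'] {P : Measure Ω} {P' : Measure Ω'}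

/-- Identically distributed pairs of a number and a nonnegative series have identically distributed
totals. -/
lemma identDistrib_add_tsum {D : Ω → ℝ} {U : ℕ → Ω → ℝ} {y : Ω' → ℝ} {V : ℕ → Ω' → ℝ}
    (h : IdentDistrib (fun ω => (D ω, fun i => U i ω)) (fun ω => (y ω, fun i => V i ω)) P P')
    (hU : ∀ ω, (fun i => U i ω) ∈ nonnegSummable)
    (hV : ∀ᵐ ω ∂P', (fun i => V i ω) ∈ nonnegSummable) :
    IdentDistrib (fun ω => D ω + ∑' i, U i ω) (fun ω => y ω + ∑' i, V i ω) P P' := by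
  have hm : Measurable fun p : ℝ × (ℕ → ℝ) => p.1 + (∑' i, ENNReal.ofReal (p.2 i)).toReal :=
    measurable_fst.add (measurable_tsum_ofReal.comp measurable_snd).ennreal_toReal
  have h1 := h.comp hm
  have hU' : (fun ω => D ω + ∑' i, U i ω)
      = (fun p : ℝ × (ℕ → ℝ) => p.1 + (∑' i, ENNReal.ofReal (p.2 i)).toReal)
        ∘ fun ω => (D ω, fun i => U i ω) :=
    funext fun ω => by simp only [Function.comp_apply, toReal_tsum_ofReal (hU ω)]
  rw [hU']
  refine h1.trans (.of_ae_eq h1.aemeasurable_snd ?_)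
  filter_upwards [hV] with ω hω
  simp only [Function.comp_apply, toReal_tsum_ofReal hω]

end SeriesLaw

/-! ### Squares of Gaussian variables. -/

section ChiSquared

variable {Ω : Type*} [MeasurableSpace Ω] {P : Measure Ω}

lemma hasLaw_chiSquared {k : ℕ} {Z : Fin k → Ω → ℝ} (hZ : ∀ i, HasLaw (Z i) (gaussianReal 0 1) P)
    (hind : iIndepFun Z P) : HasLaw (fun ω => ∑ i, Z i ω ^ 2) (chiSquared k) P := by
  have h : HasLaw (fun z : Fin k → ℝ => ∑ i, z i ^ 2) (chiSquared k)
      (Measure.pi fun _ : Fin k => gaussianReal 0 1) :=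
    ⟨(by fun_prop : Measurable fun z : Fin k → ℝ => ∑ i, z i ^ 2).aemeasurable, rfl⟩
  exact h.fun_comp (hind.hasLaw_pi hZ)

lemma hasLaw_sq_chiSquared_one :
    HasLaw (fun z : ℝ => z ^ 2) (chiSquared 1) (gaussianReal 0 1) := by
  simpa using hasLaw_chiSquared (Z := fun _ : Fin 1 => (id : ℝ → ℝ)) (fun _ => HasLaw.id)
    .of_subsingleton

/-- Scaling up from the standard normal, rather than dividing by `√v`, includes `v = 0`, hence zero
eigenvalues. -/
lemma hasLaw_sqrt_mul {v : ℝ} (hv : 0 ≤ v) :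
    HasLaw (fun z : ℝ => √v * z) (gaussianReal 0 v.toNNReal) (gaussianReal 0 1) := by
  have h := gaussianReal_const_mul (HasLaw.id (μ := gaussianReal 0 1)) √v
  convert! h using 2
  · simp
  · ext
    simp [hv]

variable {Ω' : Type*} [MeasurableSpace Ω'] {P' : Measure Ω'}

/-- A multiple of the square of a centred normal variable is a multiple of a `χ²(1)` variable. -/
lemma identDistrib_mul_sq {v : ℝ} (hv : 0 ≤ v) {ξ : Ω → ℝ} {η : Ω' → ℝ}
    (hξ : HasLaw ξ (gaussianReal 0 v.toNNReal) P) (hη : HasLaw η (chiSquared 1) P') (w : ℝ) :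
    IdentDistrib (fun ω => w * ξ ω ^ 2) (fun ω => w * v * η ω) P P' := by
  have h1 : IdentDistrib (fun ω => w * ξ ω ^ 2) (fun z : ℝ => w * (√v * z) ^ 2) P
      (gaussianReal 0 1) :=
    (hξ.identDistrib (hasLaw_sqrt_mul hv)).comp (u := fun x => w * x ^ 2) (by fun_prop)
  have h2 : IdentDistrib (fun z : ℝ => w * v * z ^ 2) (fun ω => w * v * η ω)
      (gaussianReal 0 1) P' :=
    (hasLaw_sq_chiSquared_one.identDistrib hη).const_mul (w * v)
  convert! h1.trans ?_
  convert! h2 using 2 with z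
  rw [mul_pow, Real.sq_sqrt hv]
  ring

end ChiSquared

/-! ### Uncorrelated jointly Gaussian coordinates are independent. -/

section GaussianCoordinates

variable {Ω T E : Type*} [MeasurableSpace Ω] {P : Measure Ω} [NormedAddCommGroup E]
  [NormedSpace ℝ E] [MeasurableSpace E] [BorelSpace E]

/-- Finitely many functionals form one continuous linear map, and such maps preserve Gaussian laws.
-/
lemma isGaussianProcess_apply {Y : Ω → E} (hY : HasGaussianLaw Y P) (L : T → E →L[ℝ] ℝ) :
    IsGaussianProcess (fun t ω => L t (Y ω)) P :=
  ⟨fun I => hY.map_fun (ContinuousLinearMap.pi fun t : I => L t)⟩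

variable {ξ : ℕ → Ω → ℝ} {lam : ℕ → ℝ}

lemma iIndepFun_of_isGaussianProcess (hξ : IsGaussianProcess ξ P)
    (hcov : ∀ i j, i ≠ j → cov[ξ i, ξ j; P] = 0) : iIndepFun ξ P :=
  iIndepFun_iff_finset.2 fun s => (hξ.hasGaussianLaw s).iIndepFun_of_covariance_eq_zero
    fun i j hij => hcov i j fun h => hij (Subtype.ext h)

lemma hasLaw_gaussianReal_of_isGaussianProcess (hξ : IsGaussianProcess ξ P)
    (hmean : ∀ i, P[ξ i] = 0) (hvar : ∀ i, cov[ξ i, ξ i; P] = lam i) (i : ℕ) :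
    HasLaw (ξ i) (gaussianReal 0 (lam i).toNNReal) P where
  aemeasurable := hξ.aemeasurable i
  map_eq := by
    rw [(hξ.hasGaussianLaw_eval i).map_eq_gaussianReal, hmean, ← covariance_self
      (hξ.aemeasurable i), hvar]

/-- This makes the `χ²(k)` part independent of the whole tail sequence. -/
lemma indepFun_head_tail (hξ : IsGaussianProcess ξ P)
    (hcov : ∀ i j, i ≠ j → cov[ξ i, ξ j; P] = 0) (k : ℕ) :
    IndepFun (fun ω (i : Fin k) => ξ i ω) (fun ω i => ξ (k + i) ω) P := by
  refine IsGaussianProcess.indepFun_of_covariance_eq_zero (X := fun i : Fin k => ξ i)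
    (Y := fun i => ξ (k + i)) ?_ (fun i => hξ.aemeasurable _) (fun i => hξ.aemeasurable _)
    fun i j => hcov _ _ (by omega)
  convert! hξ.comp_right (Sum.elim (fun i : Fin k => (i : ℕ)) fun i => k + i) using 1
  ext (i | i) <;> rfl

end GaussianCoordinates

/-! ### Laws of the head and of the tail of the distance. -/

section MahalanobisLaw

variable {Ω : Type*} [MeasurableSpace Ω] {P : Measure Ω} {ξ : ℕ → Ω → ℝ} {lam : ℕ → ℝ}
  {α : ℝ} {k : ℕ}

lemma stdCoeff_sq_mul (h0 : ∀ i, 0 ≤ lam i) (i : ℕ) :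
    stdCoeff α k lam (k + i) ^ 2 * lam (k + i) = lam (k + i) ^ 2 / (lam (k + i) + α) ^ 2 := by
  rw [stdCoeff, if_neg (by omega), div_pow, Real.sq_sqrt (h0 _)]
  ring

lemma hasLaw_head (h0 : ∀ i, 0 ≤ lam i) (hk : ∀ i < k, 0 < lam i)
    (hlaw : ∀ i, HasLaw (ξ i) (gaussianReal 0 (lam i).toNNReal) P) (hind : iIndepFun ξ P) :
    HasLaw (fun ω => ∑ i : Fin k, stdCoeff α k lam i ^ 2 * ξ i ω ^ 2) (chiSquared k) P := by
  have h := hasLaw_chiSquared (P := P) (Z := fun i : Fin k => fun ω => (√(lam i))⁻¹ * ξ i ω)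
    (fun i => ?_) ?_
  · convert! h using 4 with ω i
    rw [stdCoeff, if_pos i.2, mul_pow]
  · have h1 := gaussianReal_const_mul (hlaw i) (√(lam i))⁻¹
    convert! h1 using 2
    · simp
    · ext
      have := (hk i i.2).ne'
      simp [h0, this]
  · exact (hind.precomp Fin.val_injective).comp (fun (i : Fin k) x => (√(lam i))⁻¹ * x)
      fun i => by fun_prop

variable {Ω' : Type*} [MeasurableSpace Ω'] {P' : Measure Ω'} {η : ℕ → Ω' → ℝ}

/-- Independence on both sides upgrades equality of the marginals to equality in law of the
sequences, which the law of an infinite sum requires. -/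
lemma identDistrib_tail (h0 : ∀ i, 0 ≤ lam i)
    (hlaw : ∀ i, HasLaw (ξ i) (gaussianReal 0 (lam i).toNNReal) P) (hind : iIndepFun ξ P)
    (hη : ∀ i, HasLaw (η i) (chiSquared 1) P') (hηind : iIndepFun η P') :
    IdentDistrib (fun ω i => stdCoeff α k lam (k + i) ^ 2 * ξ (k + i) ω ^ 2)
      (fun ω i => lam (k + i) ^ 2 / (lam (k + i) + α) ^ 2 * η (k + i) ω) P P' := by
  have hinj : Function.Injective fun i => k + i := add_right_injective k
  refine IdentDistrib.pi (X := fun i ω => stdCoeff α k lam (k + i) ^ 2 * ξ (k + i) ω ^ 2)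
    (Y := fun i ω => lam (k + i) ^ 2 / (lam (k + i) + α) ^ 2 * η (k + i) ω) (fun i => ?_) ?_ ?_
  · rw [← stdCoeff_sq_mul h0]
    exact identDistrib_mul_sq (h0 _) (hlaw _) (hη _) _
  · exact (hind.precomp hinj).comp (fun i x => stdCoeff α k lam (k + i) ^ 2 * x ^ 2)
      fun i => by fun_prop
  · exact (hηind.precomp hinj).comp (fun i x => lam (k + i) ^ 2 / (lam (k + i) + α) ^ 2 * x)
      fun i => by fun_prop

end MahalanobisLaw

/-! ### Moments of the coordinates of the random density. -/

namespace BayesSpace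

variable {a b : ℝ} {Ω : Type*} [MeasurableSpace Ω] {P : Measure Ω} {X : Ω → BayesSpace a b}

/-- Gaussian laws have second moments, and `clr` preserves norms. -/
lemma memLp_of_hasGaussianLaw_clr (hX : AEMeasurable X P)
    (hgauss : HasGaussianLaw (fun ω => clr (X ω)) P) : MemLp X 2 P := by
  have : Fact ((2 : ENNReal) ≠ ⊤) := ⟨by simp⟩
  exact hgauss.memLp_two.of_le hX.aestronglyMeasurable
    (.of_forall fun ω => ((clrL a b).norm_map (X ω)).ge)

lemma isGaussianProcess_inner (hgauss : HasGaussianLaw (fun ω => clr (X ω)) P)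
    (ζ : ℕ → BayesSpace a b) : IsGaussianProcess (fun i ω => inner ℝ (ζ i) (X ω)) P := by
  convert! isGaussianProcess_apply hgauss fun i => innerSL ℝ (clr (ζ i)) using 3 with i ω
  exact inner_eq _ _

lemma integral_inner_of_mean_eq_zero (hX : Integrable X P) (hmean : mean P X = 0)
    (f : BayesSpace a b) : ∫ ω, inner ℝ f (X ω) ∂P = 0 := by
  have h := inner_mean hX f
  rw [hmean, inner_zero_left] at h
  rw [h]
  simp only [real_inner_comm]

lemma covariance_inner [IsProbabilityMeasure P] (hX : MemLp X 2 P) (hmean : mean P X = 0) (f g : BayesSpace a b) :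
    cov[fun ω => inner ℝ f (X ω), fun ω => inner ℝ g (X ω); P] = inner ℝ (cov P X f) g := by
  have hi := hX.integrable one_le_two
  rw [inner_cov hX, hmean, covariance, integral_inner_of_mean_eq_zero hi hmean,
    integral_inner_of_mean_eq_zero hi hmean]
  simp only [sub_zero, real_inner_comm]

variable {lam : ℕ → ℝ} {ζ : ℕ → BayesSpace a b}

lemma IsEigenpairs.inner_apply {C : BayesSpace a b →L[ℝ] BayesSpace a b}
    (h : IsEigenpairs C lam ζ) (i j : ℕ) :
    inner ℝ (C (ζ i)) (ζ j) = if i = j then lam i else 0 := by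
  rw [h.eigen, inner_smul_left, orthonormal_iff_ite.1 h.orthonormal i j]
  simp

/-- `lam i` is the second moment of `⟨X ⊖ m, ζ i⟩`. -/
lemma IsEigenpairs.nonneg [IsProbabilityMeasure P] (hX : MemLp X 2 P) (h : IsEigenpairs (cov P X) lam ζ) (i : ℕ) :
    0 ≤ lam i := by
  have h1 := h.inner_apply i i
  rw [if_pos rfl, inner_cov hX] at h1
  rw [← h1]
  exact integral_nonneg fun ω => mul_self_nonneg _

end BayesSpace

end

theorem proposition4 {a b : ℝ} (hab : a < b)
    {Ω : Type*} [MeasurableSpace Ω] (P : Measure Ω) [IsProbabilityMeasure P]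
    -- a random density with constant mean whose centred log-ratio is Gaussian in `L²(I)`
    (X : Ω → BayesSpace a b) (hX : AEMeasurable X P)
    (hgauss : HasGaussianLaw (fun ω => BayesSpace.clr (X ω)) P)
    (hmean : BayesSpace.mean P X = 0)
    -- the eigenpairs of its Bayes covariance operator (indices start at `0`)
    (lam : ℕ → ℝ) (ζ : ℕ → BayesSpace a b)
    (hpairs : BayesSpace.IsEigenpairs (BayesSpace.cov P X) lam ζ)
    (α : ℝ) (hα : 0 < α) (k : ℕ) (hk : ∀ i < k, 0 < lam i) :
    -- the standardisation is well defined
    (∀ x : BayesSpace a b, ∃! Z, BayesSpace.IsStandardization α k lam ζ x Z) ∧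
    -- the law of the squared distance of `X` from its mean
    ∀ {Ω' : Type*} [MeasurableSpace Ω'] (P' : Measure Ω') [IsProbabilityMeasure P']
      (η : ℕ → Ω' → ℝ), (∀ i, HasLaw (η i) (chiSquared 1) P') → iIndepFun η P' →
      (∀ᵐ ω' ∂P', Summable fun i => lam (k + i) ^ 2 / (lam (k + i) + α) ^ 2 * η (k + i) ω') ∧
      (k = 0 → IdentDistrib
        (fun ω => BayesSpace.sqMahalanobis α k lam ζ (X ω) (BayesSpace.mean P X))
        (fun ω' => ∑' i, lam i ^ 2 / (lam i + α) ^ 2 * η i ω') P P') ∧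
      (1 ≤ k → ∀ y : Ω' → ℝ, HasLaw y (chiSquared k) P' → IndepFun y (fun ω' i => η i ω') P' →
        IdentDistrib
          (fun ω => BayesSpace.sqMahalanobis α k lam ζ (X ω) (BayesSpace.mean P X))
          (fun ω' => y ω' + ∑' i, lam (k + i) ^ 2 / (lam (k + i) + α) ^ 2 * η (k + i) ω') P P') := by
  have hX2 := BayesSpace.memLp_of_hasGaussianLaw_clr hX hgauss
  have h0 := fun i => BayesSpace.IsEigenpairs.nonneg hX2 hpairs i
  have hζ := hpairs.orthonormal
  have hlam := hpairs.antitone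
  refine ⟨BayesSpace.existsUnique_isStandardization hα hζ hlam h0 hk, ?_⟩
  intro Ω' _ P' _ η hη hηind
  set ξ : ℕ → Ω → ℝ := fun i ω => inner ℝ (ζ i) (X ω) with hξdef
  have hξ : IsGaussianProcess ξ P := BayesSpace.isGaussianProcess_inner hgauss ζ
  have hcov : ∀ i j, cov[ξ i, ξ j; P] = if i = j then lam i else 0 := fun i j => by
    rw [← hpairs.inner_apply i j]
    exact BayesSpace.covariance_inner hX2 hmean _ _
  have hcov0 : ∀ i j, i ≠ j → cov[ξ i, ξ j; P] = 0 := fun i j hij => by rw [hcov, if_neg hij]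
  have hlaw := hasLaw_gaussianReal_of_isGaussianProcess hξ
    (fun i => BayesSpace.integral_inner_of_mean_eq_zero (hX2.integrable one_le_two) hmean _)
    (fun i => (hcov i i).trans (if_pos rfl))
  have hind := iIndepFun_of_isGaussianProcess hξ hcov0
  set D : Ω → ℝ := fun ω => ∑ i : Fin k, stdCoeff α k lam i ^ 2 * ξ i ω ^ 2 with hD
  set U : ℕ → Ω → ℝ := fun i ω => stdCoeff α k lam (k + i) ^ 2 * ξ (k + i) ω ^ 2 with hU
  set V : ℕ → Ω' → ℝ :=
    fun i ω => lam (k + i) ^ 2 / (lam (k + i) + α) ^ 2 * η (k + i) ω with hV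
  have hM : ∀ ω, HasSum (fun i => stdCoeff α k lam i ^ 2 * ξ i ω ^ 2)
      (BayesSpace.sqMahalanobis α k lam ζ (X ω) (BayesSpace.mean P X)) := fun ω => by
    rw [hmean]
    exact BayesSpace.hasSum_sqMahalanobis hα hζ hlam h0 hk (X ω)
  have hUmem : ∀ ω, (fun i => U i ω) ∈ nonnegSummable := fun ω =>
    mem_nonnegSummable.2 ⟨fun i => by positivity,
      (hM ω).summable.comp_injective (add_right_injective k)⟩
  have hMeq : (fun ω => BayesSpace.sqMahalanobis α k lam ζ (X ω) (BayesSpace.mean P X))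
      = fun ω => D ω + ∑' i, U i ω := funext fun ω => by
    have h := (hM ω).summable.sum_add_tsum_nat_add k
    rw [(hM ω).tsum_eq, Finset.sum_range] at h
    simp only [hD, hU, ← h, add_comm k]
  have hUV : IdentDistrib (fun ω i => U i ω) (fun ω i => V i ω) P P' :=
    identDistrib_tail h0 hlaw hind hη hηind
  have hVmem : ∀ᵐ ω ∂P', (fun i => V i ω) ∈ nonnegSummable :=
    -- The `U` series converges everywhere, as a tail of the series for `M²`; equality in law
    -- carries this to `V`.
    hUV.ae_mem_snd measurableSet_nonnegSummable (.of_forall hUmem)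
  refine ⟨hVmem.mono fun ω hω => (mem_nonnegSummable.1 hω).2, ?_, ?_⟩
  · rintro rfl
    -- For `k = 0` the head is an empty sum, so the constant `0` takes the place of `y`.
    have h : IdentDistrib (fun ω => ((0 : ℝ), fun i => U i ω))
        (fun ω => ((0 : ℝ), fun i => V i ω)) P P' :=
      hUV.comp (u := fun s => ((0 : ℝ), s)) (by fun_prop)
    rw [hMeq]
    simpa [hD, hV] using identDistrib_add_tsum h hUmem hVmem
  · intro _ y hy hyη
    rw [hMeq]
    -- Head and tail are independent on both sides, so their separate laws determine the joint law.
    refine identDistrib_add_tsum (IdentDistrib.prodMk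
      ((hasLaw_head h0 hk hlaw hind).identDistrib hy) hUV ?_ ?_) hUmem hVmem
    · exact (indepFun_head_tail hξ hcov0 k).comp
        (φ := fun z : Fin k → ℝ => ∑ i : Fin k, stdCoeff α k lam i ^ 2 * z i ^ 2)
        (ψ := fun (z : ℕ → ℝ) i => stdCoeff α k lam (k + i) ^ 2 * z i ^ 2)
        (by fun_prop) (by fun_prop)
    · exact hyη.comp (φ := id)
        (ψ := fun (z : ℕ → ℝ) i => lam (k + i) ^ 2 / (lam (k + i) + α) ^ 2 * z (k + i))
        measurable_id (by fun_prop)
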